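/- **Setting (BB-Core).** There are $n\ge 5f+1$ core validators $0,\dots,n-1$ ($n\ge 2$), at most $f$ of them Byzantine, the others honest. Time is counted in ticks of a global clock. The network is partially synchronous: there are $\Delta\ge 1$ and an unknown time $\mathrm{GST}$ such that every message sent at time $t$ from an honest to an honest validator arrives by $\max(t,\mathrm{GST})+\Delta$; messages take at least one tick. Byzantine validators behave arbitrarily but cannot forge signatures. *Blocks.* A block has an author, a round $R\ge 0$, transactions and an ordered list of references to blocks. It is valid if all blocks it references are valid and of earlier rounds and, for $R\ge1$, it references blocks of round $R-1$ by at least $4f+1$ distinct authors. The local DAG of a validator consists of the valid blocks whose whole causal history it has; an honest validator sends each block that enters its local DAG to everybody. A validator *enters* round $r\ge1$ when its local DAG contains blocks of round $r-1$ by $4f+1$ distinct authors (round $0$ is entered at the start). There are $L$ leader slots $(r,l)$, $0\le l<L$, per round, where $1\le L\le 4f+1$; the leader of slot $(r,l)$ is validator $(r+l)\bmod n$, and $l=0$ is the highest rank. An honest validator creates exactly one block per round, in the order of rounds: its block of round $r$ is created as soon as it has entered round $r$, has created its block of round $r-1$, and either has a block in every leader slot of round $r-1$ or entered round $r$ at least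 $2\Delta$ ago. That block references only blocks of its local DAG, among them its own previous block and a block of every author of whom it has a block of round $r-1$. *Decisions.* A block $b$ votes for a leader block $B$ if the first block by the author of $B$ in the round of $B$ met in the depth-first search from $b$ along its references is $B$. Let $r$ be the round of $B$. Direct rule, on a local DAG: go through the blocks $B$ of the slot; skip the slot if round-$(r+1)$ blocks of $4f+1$ distinct authors do not vote for $B$, commit $B$ if round-$(r+1)$ blocks of $4f+1$ distinct authors vote for $B$; otherwise the slot stays undecided. Indirect rule, for slots that the direct rule leaves undecided: the anchor is the first later slot of a round $>r+1$ that is not skipped; if the anchor is committed, with block $A$, commit a block $B$ of the slot for which round-$(r+1)$ blocks of $2f+1$ distinct authors vote for $B$ and are linked from $A$, if there is one, and skip the slot if there is none; otherwise the slot stays undecided. A validator applies the rules to all slots up to the highest round of its local DAG, from the last slot to the first. Say that a round *lies after GST* if no honest validator enters it before $\mathrm{GST}+2\Delta$ (so that the timers started before $\mathrm{GST}$ have run out). **Theorem (liveness of BB-Core).** In every execution: 1. Every honest validator enters every round and creates a block in it. 2. If an honest validator has entered round $r$ by time $t$, then every honest validator has entered round $r$ by $\max(t,\mathrm{GST})+\Delta$.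 3. All but finitely many rounds lie after GST. If round $r$ lies after GST and the leader of slot $(r,l)$ is honest, then its block of round $r$ is directly committed by every honest validator (from some time on, the direct rule on its local DAG returns the commitment of that block). 4. Any $2f+2$ consecutive rounds contain two consecutive rounds $j,j+1$ whose highest-ranked leaders are honest. If the first of the $2f+2$ rounds lies after GST, then $j$ can be chosen so that, moreover, the blocks of both these leaders are directly committed by every honest validator, and so that every honest validator from some time on has decided (committed or skipped) every leader slot of the rounds before $j$. 5. Consequently, for every leader slot and every honest validator there is a time from which on the slot is decided at that validator. -/

import Mathlib

namespace BBCore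

universe u

/-! ### Blocks and the DAG -/

/-- A block carries its author (one of the `n` validators), its round, a list of transactions and
the ordered list of the blocks it references.  References are collision-free hashes, so a
reference determines the referenced block, and with it the whole causal history. -/
inductive Block (n : ℕ) (Tx : Type u) : Type u
  | mk (author : Fin n) (round : ℕ) (txs : List Tx) (parents : List (Block n Tx)) : Block n Tx

namespace Block

variable {n : ℕ} {Tx : Type u}

def author : Block n Tx → Fin n
  | mk a _ _ _ => a

def round : Block n Tx → ℕ
  | mk _ r _ _ => r

def txs : Block n Tx → List Tx
  | mk _ _ ts _ => ts

def parents : Block n Tx → List (Block n Tx)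
  | mk _ _ _ ps => ps

theorem sizeOf_lt_of_mem_parents {b p : Block n Tx} (h : p ∈ b.parents) :
    sizeOf p < sizeOf b := by
  cases b with
  | mk a r ts ps =>
    have h1 : sizeOf p < sizeOf ps := List.sizeOf_lt_of_mem h
    simp only [mk.sizeOf_spec]
    omega

/-- The causal history of a block: the block itself and everything reachable from it by following
references. -/
def history (b : Block n Tx) : Set (Block n Tx) :=
  {c | Relation.ReflTransGen (fun p q => p ∈ q.parents) c b}

/-- The depth-first search for a block of author `id` and round `r` below `b`. -/
def votedBlock (id : Fin n) (r : ℕ) (b : Block n Tx) : Option (Block n Tx) :=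
  if b.round ≤ r then none
  else b.parents.attach.findSome? fun p =>
    if p.1.author = id ∧ p.1.round = r then some p.1 else votedBlock id r p.1
termination_by sizeOf b
decreasing_by exact sizeOf_lt_of_mem_parents p.2

/-- `b` votes for `bl`. -/
def IsVote (b bl : Block n Tx) : Prop := votedBlock bl.author bl.round b = some bl

/-- Well-formed blocks with fault parameter `f`: all referenced blocks are valid and of earlier
rounds, and a block of a round `R > 0` references blocks of round `R - 1` by at least `4 f + 1`
distinct authors.  (Signatures are dealt with by `Execution.unforgeable` below.)  Round `0` is the
first round; its blocks reference nothing. -/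
inductive Valid (f : ℕ) : Block n Tx → Prop
  | intro (b : Block n Tx) (valid : ∀ p ∈ b.parents, Valid f p)
      (earlier : ∀ p ∈ b.parents, p.round < b.round)
      (quorum : 0 < b.round →
        4 * f + 1 ≤ {a : Fin n | ∃ p ∈ b.parents, p.round + 1 = b.round ∧ p.author = a}.ncard) :
      Valid f b

end Block

/-- The number of distinct authors of a set of blocks. -/
noncomputable def authorCount {n : ℕ} {Tx : Type u} (B : Set (Block n Tx)) : ℕ :=
  (Block.author '' B).ncard

/-! ### The decision rules

`D` is a local DAG; `DAG[r]` is the set of its round-`r` blocks.  Every round `r` is the propose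
round of a wave whose decision round is `r + 1`.  A leader slot is a pair (round, rank). -/

/-- Round-robin leader schedule: the leader of rank `l` in round `r` is `validators[(r+l) mod n]`. -/
def leader (n : ℕ) [NeZero n] (r l : ℕ) : Fin n := Fin.ofNat n (r + l)

/-- The possible states of a leader slot. -/
inductive Status (n : ℕ) (Tx : Type u) : Type u
  | commit (b : Block n Tx) : Status n Tx
  | skip : Status n Tx
  | undecided : Status n Tx

def Status.isSkip {n : ℕ} {Tx : Type u} : Status n Tx → Bool
  | .skip => true
  | _ => false

section Decider

variable {n : ℕ} [NeZero n] {Tx : Type u}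

def roundBlocks (D : Set (Block n Tx)) (r : ℕ) : Set (Block n Tx) := {b ∈ D | b.round = r}

def leaderBlocks (D : Set (Block n Tx)) (r l : ℕ) : Set (Block n Tx) :=
  {b ∈ roundBlocks D r | b.author = leader n r l}

def StronglyCertified (f : ℕ) (D : Set (Block n Tx)) (bl : Block n Tx) : Prop :=
  4 * f + 1 ≤ authorCount {b ∈ roundBlocks D (bl.round + 1) | b.IsVote bl}

def Skipped (f : ℕ) (D : Set (Block n Tx)) (bl : Block n Tx) : Prop :=
  4 * f + 1 ≤ authorCount {b ∈ roundBlocks D (bl.round + 1) | ¬ b.IsVote bl}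

/-- `Link D bOld bNew`: a chain of references inside `D` leads from `bNew` back to `bOld`. -/
def Link (D : Set (Block n Tx)) (bOld bNew : Block n Tx) : Prop :=
  Relation.ReflTransGen (fun p q => q ∈ D ∧ p ∈ q.parents) bOld bNew

def WeaklyCertified (f : ℕ) (D : Set (Block n Tx)) (anchor bl : Block n Tx) : Prop :=
  2 * f + 1 ≤
    authorCount {b ∈ roundBlocks D (bl.round + 1) | b.IsVote bl ∧ Link D b anchor}

/-- `TryDirectDecide f D r l s`: the direct rule, looping over the blocks of the slot `(r, l)` in
some order, can return `s`.  (For an equivocating leader the result may depend on the order; for a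
slot with at most one block it does not.) -/
def TryDirectDecide (f : ℕ) (D : Set (Block n Tx)) (r l : ℕ) : Status n Tx → Prop
  | .commit b => b ∈ leaderBlocks D r l ∧ ¬ Skipped f D b ∧ StronglyCertified f D b
  | .skip => ∃ b ∈ leaderBlocks D r l, Skipped f D b
  | .undecided => ∀ b ∈ leaderBlocks D r l, ¬ Skipped f D b ∧ ¬ StronglyCertified f D b

/-- The anchor of a slot of round `r`: the first entry of `S` of a round beyond the decision round
`r + 1` that is not skipped. -/
def anchor (S : List ((ℕ × ℕ) × Status n Tx)) (r : ℕ) : Option (Status n Tx) :=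
  (S.find? fun e => decide (r + 1 < e.1.1) && !e.2.isSkip).map Prod.snd

/-- `TryIndirectDecide f D r l S s`: the indirect rule, applied to the slot `(r, l)` when `S` is the
list of the later slots with their states, can return `s`. -/
def TryIndirectDecide (f : ℕ) (D : Set (Block n Tx)) (r l : ℕ)
    (S : List ((ℕ × ℕ) × Status n Tx)) : Status n Tx → Prop
  | .commit b => ∃ ba, anchor S r = some (.commit ba) ∧
      b ∈ leaderBlocks D r l ∧ WeaklyCertified f D ba b
  | .skip => ∃ ba, anchor S r = some (.commit ba) ∧
      ∀ b ∈ leaderBlocks D r l, ¬ WeaklyCertified f D ba b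
  | .undecided => ∀ ba, anchor S r ≠ some (.commit ba)

/-- A run of the decision procedure over an ascending list of slots.  The slots are processed from
the last to the first, each by the direct rule and, if that returns `undecided`, by the indirect
rule; the result is put in front of the list of states. -/
inductive TryDecide (f : ℕ) (D : Set (Block n Tx)) :
    List (ℕ × ℕ) → List ((ℕ × ℕ) × Status n Tx) → Prop
  | nil : TryDecide f D [] []
  | direct {slots S} (r l : ℕ) (s : Status n Tx) : TryDecide f D slots S →
      TryDirectDecide f D r l s → s ≠ .undecided →
      TryDecide f D ((r, l) :: slots) (((r, l), s) :: S)
  | indirect {slots S} (r l : ℕ) (s : Status n Tx) : TryDecide f D slots S →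
      TryDirectDecide f D r l .undecided → TryIndirectDecide f D r l S s →
      TryDecide f D ((r, l) :: slots) (((r, l), s) :: S)

/-- The slots of the rounds `lo, …, hi` in ascending order, `L` of them per round. -/
def slots (L lo hi : ℕ) : List (ℕ × ℕ) :=
  (List.range' lo (hi + 1 - lo)).flatMap fun r => (List.range L).map fun l => (r, l)

/-- The direct rule commits the block `b` in the slot `(r, l)` (and can return nothing else). -/
def DirectlyCommits (f : ℕ) (D : Set (Block n Tx)) (r l : ℕ) (b : Block n Tx) : Prop :=
  ∀ s, TryDirectDecide f D r l s ↔ s = .commit b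

/-- The decision procedure, run on the local DAG `D` from round `lo` (the round after
`r_committed`) up to the highest round of `D`, decides the slot `(r, l)`, in whatever order it goes
through equivocating blocks. -/
def Decided (f L : ℕ) (D : Set (Block n Tx)) (lo r l : ℕ) : Prop :=
  ∃ hi, IsGreatest (Block.round '' D) hi ∧
    (∃ S, TryDecide f D (slots L lo hi) S) ∧
    ∀ S, TryDecide f D (slots L lo hi) S → ∃ s, ((r, l), s) ∈ S ∧ s ≠ .undecided

end Decider

/-! ### Executions -/

/-- What happens in an execution: the set of Byzantine validators, and the block creations, message
sendings and message receptions with their times (ticks of a global clock).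
`propose v t b`: the honest validator `v` creates `b` at time `t`;
`sent v w t b`: `v` sends `b` to `w` at time `t`;
`recv v w t b`: `w` receives `b` from `v` at time `t`. -/
structure Trace (n : ℕ) (Tx : Type u) where
  byz : Finset (Fin n)
  propose : Fin n → ℕ → Block n Tx → Prop
  sent : Fin n → Fin n → ℕ → Block n Tx → Prop
  recv : Fin n → Fin n → ℕ → Block n Tx → Prop

namespace Trace

variable {n : ℕ} {Tx : Type u}

def Honest (E : Trace n Tx) (v : Fin n) : Prop := v ∉ E.byz

/-- The blocks that `v` has created or received by time `t`. -/
def received (E : Trace n Tx) (v : Fin n) (t : ℕ) : Set (Block n Tx) :=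
  {b | ∃ t' ≤ t, E.propose v t' b ∨ ∃ w, E.recv w v t' b}

/-- The local DAG of `v` at time `t`: the valid blocks whose entire causal history `v` has. -/
def dag (E : Trace n Tx) (f : ℕ) (v : Fin n) (t : ℕ) : Set (Block n Tx) :=
  {b | b.Valid f ∧ b.history ⊆ E.received v t}

/-- By time `t`, `v` has entered round `r`: its local DAG holds blocks of round `r - 1` by at least
`4 f + 1` distinct authors (round `0` is entered at the start). -/
def Entered (E : Trace n Tx) (f : ℕ) (v : Fin n) : ℕ → ℕ → Prop
  | 0, _ => True
  | r + 1, t => 4 * f + 1 ≤ authorCount (roundBlocks (E.dag f v t) r)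

/-- By time `t`, `v` has waited long enough for the leaders of round `r - 1`: it has a block in each
of their `L` slots, or it entered round `r` at least `2 Δ` ago. -/
def Waited [NeZero n] (E : Trace n Tx) (f L Δ : ℕ) (v : Fin n) : ℕ → ℕ → Prop
  | 0, _ => True
  | r + 1, t => (∀ l < L, (leaderBlocks (E.dag f v t) r l).Nonempty) ∨
      ∃ t₀, t₀ + 2 * Δ ≤ t ∧ E.Entered f v (r + 1) t₀

/-- By time `t`, `v` has created a block of round `r`. -/
def Proposed (E : Trace n Tx) (v : Fin n) (r t : ℕ) : Prop :=
  ∃ t' ≤ t, ∃ b, E.propose v t' b ∧ b.round = r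

/-- At time `t`, `v` may create its block of round `r`. -/
def Ready [NeZero n] (E : Trace n Tx) (f L Δ : ℕ) (v : Fin n) (r t : ℕ) : Prop :=
  E.Entered f v r t ∧ E.Waited f L Δ v r t ∧ ∀ r', r' + 1 = r → E.Proposed v r' t

end Trace

/-- Executions of the protocol with `n` core validators, at most `f` of them Byzantine, `L` leader
slots per round, in a partially synchronous network with delay bound `Δ` and global stabilization
time `GST`.  Byzantine validators may send any blocks to anybody at any time, except that they
cannot forge signatures of honest validators. -/
structure Execution (n : ℕ) [NeZero n] (Tx : Type u) (f L Δ GST : ℕ) extends Trace n Tx where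
  byz_card : byz.card ≤ f
  /-- Channels are authenticated, and a message takes at least one tick. -/
  recv_sent : ∀ v w t b, recv v w t b → ∃ t' < t, sent v w t' b
  /-- Partial synchrony: a message between honest validators sent at time `t` arrives by
  `max t GST + Δ`. -/
  delivery : ∀ v w t b, toTrace.Honest v → toTrace.Honest w → sent v w t b →
    ∃ t' ≤ max t GST + Δ, recv v w t' b
  /-- No message contains a block in the name of an honest validator that this validator did not
  create before. -/
  unforgeable : ∀ v w t b, sent v w t b → ∀ c ∈ b.history, toTrace.Honest c.author →
    ∃ t' ≤ t, propose c.author t' c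
  /-- Best-effort broadcast: an honest validator sends every block to everybody as soon as the block
  enters its local DAG. -/
  broadcast : ∀ v t b, toTrace.Honest v → b ∈ toTrace.dag f v t →
    ∀ w, ∃ t' ≤ t, sent v w t' b
  /-- Honest validators send only blocks of their local DAG. -/
  sent_dag : ∀ v w t b, toTrace.Honest v → sent v w t b → b ∈ toTrace.dag f v t
  /-- Honest validators create at most one block per round. -/
  propose_unique : ∀ v t t' b b', toTrace.Honest v → propose v t b → propose v t' b' →
    b.round = b'.round → t = t' ∧ b = b'
  propose_author : ∀ v t b, toTrace.Honest v → propose v t b → b.author = v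
  propose_ready : ∀ v t b, toTrace.Honest v → propose v t b →
    toTrace.Ready f L Δ v b.round t
  /-- The blocks referenced by an honest validator are in its local DAG, and of earlier rounds. -/
  parents_dag : ∀ v t b, toTrace.Honest v → propose v t b →
    ∀ p ∈ b.parents, p ∈ toTrace.dag f v t ∧ p.round < b.round
  /-- Honest validators reference their own previous block. -/
  parents_own : ∀ v t b, toTrace.Honest v → propose v t b → 0 < b.round →
    ∃ p ∈ b.parents, p.author = v ∧ p.round + 1 = b.round
  /-- Honest validators reference a block of every author of whom they have a block of the previous
  round. -/
  parents_all : ∀ v t b, toTrace.Honest v → propose v t b →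
    ∀ c ∈ toTrace.dag f v t, c.round + 1 = b.round →
      ∃ p ∈ b.parents, p.author = c.author ∧ p.round = c.round
  /-- Honest validators create their block of a round as soon as they may. -/
  prompt : ∀ v t r, toTrace.Honest v → toTrace.Ready f L Δ v r t → toTrace.Proposed v r t

namespace Execution

variable {n : ℕ} [NeZero n] {Tx : Type u} {f L Δ GST : ℕ}

/-- Round `r` lies after GST: no honest validator enters it before `GST + 2 Δ`, when all round
timers that were started before GST have run out. -/
def AfterGST (E : Execution n Tx f L Δ GST) (r : ℕ) : Prop :=
  ∀ v t, E.Honest v → E.Entered f v r t → GST + 2 * Δ ≤ t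

/-- The leader of the slot `(r, l)` creates a block, and every honest validator from some time on
directly commits that block. -/
def EventuallyDirectlyCommitted (E : Execution n Tx f L Δ GST) (r l : ℕ) : Prop :=
  ∃ b : Block n Tx, b.round = r ∧ (∃ t, E.propose (leader n r l) t b) ∧
    ∀ v, E.Honest v → ∃ T, ∀ t ≥ T, DirectlyCommits f (E.dag f v t) r l b

end Execution

end BBCore

/-! Progress: once all honest validators have created their blocks of a round, these at least `n - f
≥ 4 f + 1` blocks reach everybody, so everybody enters the next round, and the timer bounds the wait
for leaders (`exists_entered_and_proposed`). Conversely, rounds cannot race ahead of the clock: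
since messages take a tick, an honest block of round `r + 2` needs an honest block of round `r` at a
strictly earlier time (`exists_earlier_propose`). Hence local DAGs have a highest round, and almost
all rounds lie after GST.

Commitment: after GST, honest validators create their blocks of a round within `Δ` of each other
(`proposed_within`), and one more `Δ` delivers them. So a timer of `2 Δ` cannot run out before an
honest leader's block arrives. Every honest block of the next round then references it and, as
honest leaders do not equivocate, votes for it (`isVote_leader`). These votes form a commit quorum
and preclude a skip quorum.

Decision: among `f + 1` disjoint pairs of consecutive rounds, some pair has two honest top leaders.
Two consecutive top-ranked commitments leave no room for an undecided anchor below them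
(`TryDecide.ne_undecided`), so all earlier slots are decided. -/

namespace BBCore

/-! ### Blocks and votes -/

namespace Block

variable {n : ℕ} {Tx : Type*}

theorem self_mem_history (b : Block n Tx) : b ∈ b.history := Relation.ReflTransGen.refl

theorem history_subset_of_mem {b c : Block n Tx} (h : c ∈ b.history) : c.history ⊆ b.history :=
  fun _ hd => Relation.ReflTransGen.trans hd h

theorem mem_history_of_mem_parents {b p : Block n Tx} (h : p ∈ b.parents) : p ∈ b.history :=
  Relation.ReflTransGen.single h

theorem eq_or_mem_history_parent {b c : Block n Tx} (h : c ∈ b.history) :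
    c = b ∨ ∃ p ∈ b.parents, c ∈ p.history := by
  rcases Relation.ReflTransGen.cases_tail h with h | ⟨p, hcp, hp⟩
  · exact Or.inl h.symm
  · exact Or.inr ⟨p, hp, hcp⟩

theorem Valid.of_mem_history {f : ℕ} {b c : Block n Tx} (hb : b.Valid f) (hc : c ∈ b.history) :
    c.Valid f := by
  induction hb with
  | intro b valid earlier quorum ih =>
    rcases eq_or_mem_history_parent hc with rfl | ⟨p, hp, hcp⟩
    · exact .intro c valid earlier quorum
    · exact ih p hp hcp

theorem Valid.exists_parent_author_notMem {f : ℕ} {b : Block n Tx} (hb : b.Valid f)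
    (hr : 0 < b.round) (X : Finset (Fin n)) (hX : X.card ≤ 4 * f) :
    ∃ p ∈ b.parents, p.round + 1 = b.round ∧ p.author ∉ X := by
  cases hb with
  | intro _ _ _ quorum =>
    by_contra! hcon
    have hsub : {a : Fin n | ∃ p ∈ b.parents, p.round + 1 = b.round ∧ p.author = a} ⊆ ↑X := by
      rintro a ⟨p, hp, hpr, rfl⟩
      exact hcon p hp hpr
    have hle := Set.ncard_le_ncard hsub X.finite_toSet
    rw [Set.ncard_coe_finset] at hle
    have := quorum hr
    omega

theorem votedBlock_eq_some {id : Fin n} {r : ℕ} {b c : Block n Tx}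
    (h : votedBlock id r b = some c) : c.author = id ∧ c.round = r ∧ c ∈ b.history := by
  rw [votedBlock] at h
  split_ifs at h
  obtain ⟨⟨p, hp⟩, -, hpc⟩ := List.exists_of_findSome?_eq_some h
  dsimp only at hpc
  split_ifs at hpc with hid
  · cases hpc
    exact ⟨hid.1, hid.2, mem_history_of_mem_parents hp⟩
  · obtain ⟨h1, h2, h3⟩ := votedBlock_eq_some hpc
    exact ⟨h1, h2, history_subset_of_mem (mem_history_of_mem_parents hp) h3⟩
termination_by sizeOf b
decreasing_by exact sizeOf_lt_of_mem_parents hp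

/-- The search may stop at another block of the same slot before it meets `p`, so only its success
is claimed. -/
theorem exists_votedBlock {b p : Block n Tx} (hp : p ∈ b.parents) (hr : p.round < b.round) :
    ∃ c, votedBlock p.author p.round b = some c := by
  rw [← Option.isSome_iff_exists, votedBlock, if_neg (not_le.2 hr), List.findSome?_isSome_iff]
  exact ⟨⟨p, hp⟩, List.mem_attach _ _, by simp⟩

/-- A block votes for `p` if it references `p` and its history has no other block in the slot. -/
theorem isVote_of_mem_parents {b p : Block n Tx} (hp : p ∈ b.parents) (hr : p.round < b.round)
    (huniq : ∀ c ∈ b.history, c.author = p.author → c.round = p.round → c = p) : b.IsVote p := by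
  obtain ⟨c, hc⟩ := exists_votedBlock hp hr
  obtain ⟨h1, h2, h3⟩ := votedBlock_eq_some hc
  rw [IsVote, hc, huniq c h3 h1 h2]

end Block

/-! ### Quorum counting -/

section AuthorCount

variable {n : ℕ} {Tx : Type*}

theorem authorCount_mono {A B : Set (Block n Tx)} (h : A ⊆ B) : authorCount A ≤ authorCount B :=
  Set.ncard_le_ncard (Set.image_mono h) (Set.toFinite _)

theorem exists_author_notMem {A : Set (Block n Tx)} (X : Finset (Fin n))
    (h : X.card < authorCount A) : ∃ b ∈ A, b.author ∉ X := by
  by_contra! hcon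
  have hle := Set.ncard_le_ncard (Set.image_subset_iff.2 hcon : Block.author '' A ⊆ ↑X)
    X.finite_toSet
  rw [Set.ncard_coe_finset] at hle
  unfold authorCount at h
  omega

theorem le_authorCount_of_honest {A : Set (Block n Tx)} {f : ℕ} (hn : 5 * f + 1 ≤ n)
    (X : Finset (Fin n)) (hX : X.card ≤ f) (h : ∀ v ∉ X, ∃ b ∈ A, b.author = v) :
    4 * f + 1 ≤ authorCount A := by
  have hsub : (↑(Xᶜ) : Set (Fin n)) ⊆ Block.author '' A := fun v hv =>
    h v (by simpa using hv)
  have hle := Set.ncard_le_ncard hsub (Set.toFinite _)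
  rw [Set.ncard_coe_finset, Finset.card_compl, Fintype.card_fin] at hle
  unfold authorCount
  omega

end AuthorCount

/-! ### The leader schedule -/

theorem leader_ne {n : ℕ} [NeZero n] {a b : ℕ} (hab : a < b) (hb : b < a + n) :
    leader n a 0 ≠ leader n b 0 := by
  intro h
  have h' : (a + 0) % n = (b + 0) % n := congrArg Fin.val h
  simp only [add_zero] at h'
  have hd : n ∣ b - a := (Nat.modEq_iff_dvd' hab.le).1 h'
  have := Nat.le_of_dvd (by omega) hd
  omega

/-- Pigeonhole on the `f + 1` disjoint pairs of rounds `r₀ + 2 i`, `r₀ + 2 i + 1`: if each had a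
leader in `X`, two of these leaders would coincide. But `2 f + 2 ≤ n` (by `hn` if `f > 0`, by `hn2`
if `f = 0`), so leaders are distinct throughout the window. -/
theorem exists_consecutive_leaders_notMem {n : ℕ} [NeZero n] {f : ℕ} (hn2 : 2 ≤ n)
    (hn : 5 * f + 1 ≤ n) (X : Finset (Fin n)) (hX : X.card ≤ f) (r₀ : ℕ) :
    ∃ j, r₀ ≤ j ∧ j + 1 ≤ r₀ + (2 * f + 1) ∧ leader n j 0 ∉ X ∧ leader n (j + 1) 0 ∉ X := by
  by_contra! hcon
  have hbad : ∀ i ∈ Finset.range (f + 1), ∃ k < 2, leader n (r₀ + 2 * i + k) 0 ∈ X := by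
    intro i hi
    rw [Finset.mem_range] at hi
    by_cases h0 : leader n (r₀ + 2 * i) 0 ∈ X
    · exact ⟨0, by omega, h0⟩
    · exact ⟨1, by omega, hcon _ (by omega) (by omega) h0⟩
  choose! k hk hmem using hbad
  obtain ⟨x, hx, y, hy, hxy, heq⟩ := Finset.exists_ne_map_eq_of_card_lt_of_maps_to
    (s := Finset.range (f + 1)) (t := X) (by rw [Finset.card_range]; omega)
    (f := fun i => leader n (r₀ + 2 * i + k i) 0) hmem
  have hkx := hk x hx
  have hky := hk y hy
  rw [Finset.mem_range] at hx hy
  rcases Nat.lt_or_gt_of_ne hxy with h | h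
  · exact leader_ne (by omega) (by omega) heq
  · exact leader_ne (by omega) (by omega) heq.symm

/-! ### The decision procedure -/

/-- The order in which slots are listed: by round, then by rank. -/
def SlotLT (x y : ℕ × ℕ) : Prop := x.1 < y.1 ∨ x.1 = y.1 ∧ x.2 < y.2

/-- The anchor does not come after any later slot that is not skipped. -/
theorem anchor_spec {n : ℕ} {Tx : Type*} {S : List ((ℕ × ℕ) × Status n Tx)} (hS : (S.map Prod.fst).Pairwise SlotLT)
    {r : ℕ} {y : (ℕ × ℕ) × Status n Tx} (hy : y ∈ S) (hry : r + 1 < y.1.1)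
    (hys : y.2.isSkip = false) :
    ∃ e ∈ S, anchor S r = some e.2 ∧ r + 1 < e.1.1 ∧ e.2.isSkip = false ∧
      ∀ z ∈ S, r + 1 < z.1.1 → z.2.isSkip = false → z = e ∨ SlotLT e.1 z.1 := by
  obtain ⟨e, he⟩ : ∃ e, S.find? (fun e => decide (r + 1 < e.1.1) && !e.2.isSkip) = some e := by
    rw [← Option.isSome_iff_exists, List.find?_isSome]
    exact ⟨y, hy, by simp [hry, hys]⟩
  have hanchor : anchor S r = some e.2 := by rw [anchor, he]; rfl
  rw [List.find?_eq_some_iff_append] at he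
  obtain ⟨hpe, as, bs, rfl, has⟩ := he
  simp only [Bool.and_eq_true, decide_eq_true_eq, Bool.not_eq_true'] at hpe
  refine ⟨e, by simp, hanchor, hpe.1, hpe.2, fun z hz hrz hzs => ?_⟩
  rcases List.mem_append.1 hz with h | h
  · have := has z h
    simp [hrz, hzs] at this
  · rcases List.mem_cons.1 h with h | h
    · exact Or.inl h
    · rw [List.pairwise_map, List.pairwise_append] at hS
      exact Or.inr ((List.pairwise_cons.1 hS.2.1).1 z h)

section Decider

variable {n : ℕ} [NeZero n] {Tx : Type*} {f L : ℕ} {D : Set (Block n Tx)}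

theorem exists_tryDirectDecide (f : ℕ) (D : Set (Block n Tx)) (r l : ℕ) :
    ∃ s, TryDirectDecide f D r l s := by
  by_cases h1 : ∃ b ∈ leaderBlocks D r l, Skipped f D b
  · exact ⟨.skip, h1⟩
  push Not at h1
  by_cases h2 : ∃ b ∈ leaderBlocks D r l, StronglyCertified f D b
  · obtain ⟨b, hb, hs⟩ := h2
    exact ⟨.commit b, hb, h1 b hb, hs⟩
  push Not at h2
  exact ⟨.undecided, fun b hb => ⟨h1 b hb, h2 b hb⟩⟩

theorem exists_tryIndirectDecide (f : ℕ) (D : Set (Block n Tx)) (r l : ℕ)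
    (S : List ((ℕ × ℕ) × Status n Tx)) : ∃ s, TryIndirectDecide f D r l S s := by
  by_cases h1 : ∃ ba, anchor S r = some (.commit ba)
  · obtain ⟨ba, hba⟩ := h1
    by_cases h2 : ∃ b ∈ leaderBlocks D r l, WeaklyCertified f D ba b
    · obtain ⟨b, hb, hw⟩ := h2
      exact ⟨.commit b, ba, hba, hb, hw⟩
    · push Not at h2
      exact ⟨.skip, ba, hba, h2⟩
  · push Not at h1
    exact ⟨.undecided, h1⟩

/-- The rules never get stuck; this is the existence of a run that `Decided` demands. -/
theorem exists_tryDecide (f : ℕ) (D : Set (Block n Tx)) (sl : List (ℕ × ℕ)) :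
    ∃ S, TryDecide f D sl S := by
  induction sl with
  | nil => exact ⟨[], .nil⟩
  | cons x sl ih =>
    obtain ⟨S, hS⟩ := ih
    obtain ⟨r, l⟩ := x
    obtain ⟨s, hs⟩ := exists_tryDirectDecide f D r l
    by_cases hu : s = .undecided
    · subst hu
      obtain ⟨s', hs'⟩ := exists_tryIndirectDecide f D r l S
      exact ⟨_, .indirect r l s' hS hs hs'⟩
    · exact ⟨_, .direct r l s hS hs hu⟩

theorem TryDecide.map_fst {sl : List (ℕ × ℕ)} {S : List ((ℕ × ℕ) × Status n Tx)}
    (h : TryDecide f D sl S) : S.map Prod.fst = sl := by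
  induction h with
  | nil => rfl
  | direct r l s _ _ _ ih => simp [ih]
  | indirect r l s _ _ _ ih => simp [ih]

theorem TryDecide.eq_commit {sl : List (ℕ × ℕ)} {S : List ((ℕ × ℕ) × Status n Tx)}
    (h : TryDecide f D sl S) {r l : ℕ} {b : Block n Tx} (hb : DirectlyCommits f D r l b)
    {s : Status n Tx} (hs : ((r, l), s) ∈ S) : s = .commit b := by
  induction h with
  | nil => cases hs
  | direct r' l' s' _ hd _ ih =>
    rcases List.mem_cons.1 hs with h | h
    · cases h
      exact (hb _).1 hd
    · exact ih h
  | indirect r' l' s' _ hd _ ih =>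
    rcases List.mem_cons.1 hs with h | h
    · cases h
      cases (hb _).1 hd
    · exact ih h

theorem pairwise_slots (L lo hi : ℕ) : (slots L lo hi).Pairwise SlotLT := by
  rw [slots, List.pairwise_flatMap]
  refine ⟨fun r _ => ?_, ?_⟩
  · rw [List.pairwise_map]
    exact List.pairwise_lt_range.imp fun h => Or.inr ⟨rfl, h⟩
  · refine (List.pairwise_lt_range' (s := lo)).imp fun {a b} h x hx y hy => ?_
    obtain ⟨_, _, rfl⟩ := List.mem_map.1 hx
    obtain ⟨_, _, rfl⟩ := List.mem_map.1 hy
    exact Or.inl h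

theorem mem_slots {L lo hi r l : ℕ} (hlo : lo ≤ r) (hhi : r ≤ hi) (hl : l < L) :
    (r, l) ∈ slots L lo hi := by
  simp only [slots, List.mem_flatMap, List.mem_range'_1, List.mem_map, List.mem_range]
  exact ⟨r, by omega, l, hl, rfl⟩

/-- Two commitments are needed because an anchor lies beyond the decision round: `(j, 0)` is no
candidate for a slot of round `j - 1`, but `(j + 1, 0)` is. The hypothesis `hmem` is conditional so
that it passes to all tails of the list, including those that no longer contain `(j, 0)`. -/
theorem TryDecide.ne_undecided {sl : List (ℕ × ℕ)} {S : List ((ℕ × ℕ) × Status n Tx)}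
    (h : TryDecide f D sl S) {j : ℕ} {b₀ b₁ : Block n Tx} (hb₀ : DirectlyCommits f D j 0 b₀)
    (hb₁ : DirectlyCommits f D (j + 1) 0 b₁) (hsl : sl.Pairwise SlotLT)
    (hmem : ∀ x ∈ sl, x.1 < j → (j, 0) ∈ sl ∧ (j + 1, 0) ∈ sl) :
    ∀ e ∈ S, e.1.1 < j → e.2 ≠ .undecided := by
  induction h with
  | nil => simp
  | direct r l s hrun hd hu ih =>
    have htail := List.pairwise_cons.1 hsl
    intro e he hej
    rcases List.mem_cons.1 he with rfl | he
    · exact hu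
    · refine ih htail.2 (fun x hx hxj => ?_) e he hej
      -- The head precedes `x`, a slot of a round before `j`, so it is neither `(j, 0)` nor `(j + 1,
      -- 0)`.
      have hlt := htail.1 x hx
      obtain ⟨h0, h1⟩ := hmem x (List.mem_cons_of_mem _ hx) hxj
      simp only [SlotLT] at hlt
      simp only [List.mem_cons, Prod.mk.injEq] at h0 h1
      exact ⟨h0.resolve_left (by omega), h1.resolve_left (by omega)⟩
  | @indirect sl S r l s hrun hd hi ih =>
    have htail := List.pairwise_cons.1 hsl
    have ih' := ih htail.2 fun x hx hxj => by
      have hlt := htail.1 x hx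
      obtain ⟨h0, h1⟩ := hmem x (List.mem_cons_of_mem _ hx) hxj
      simp only [SlotLT] at hlt
      simp only [List.mem_cons, Prod.mk.injEq] at h0 h1
      exact ⟨h0.resolve_left (by omega), h1.resolve_left (by omega)⟩
    intro e he hej
    rcases List.mem_cons.1 he with rfl | he
    swap
    · exact ih' e he hej
    rintro rfl
    dsimp only at hej
    obtain ⟨h0, h1⟩ := hmem (r, l) List.mem_cons_self hej
    simp only [List.mem_cons, Prod.mk.injEq] at h0 h1
    have h0' := h0.resolve_left (by omega)
    have h1' := h1.resolve_left (by omega)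
    rw [← hrun.map_fst, List.mem_map] at h0' h1'
    obtain ⟨⟨_, s₀⟩, hy₀, rfl⟩ := h0'
    obtain ⟨⟨_, s₁⟩, hy₁, rfl⟩ := h1'
    obtain rfl := hrun.eq_commit hb₀ hy₀
    obtain rfl := hrun.eq_commit hb₁ hy₁
    -- Since `r < j`, the slot `(j + 1, 0)` is beyond the decision round `r + 1`, so an anchor
    -- exists.
    obtain ⟨⟨⟨r', l'⟩, s'⟩, heS, hanchor, hre, hskip, hfirst⟩ :=
      anchor_spec (r := r) (by rw [hrun.map_fst]; exact htail.2) hy₁ (by dsimp only; omega) rfl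
    cases s' with
    | commit ba => exact hi ba hanchor
    | skip => cases hskip
    | undecided =>
      -- By induction an undecided anchor has round at least `j`; it strictly precedes the committed
      -- `(j + 1, 0)`, so its round is `j`. Then `r + 1 < j`, so `(j, 0)` is a candidate too, and
      -- the anchor would have to precede the first slot of its own round.
      have hr' : ¬ r' < j := fun hlt => ih' _ heS hlt rfl
      dsimp only at hre
      have hlt₁ := hfirst _ hy₁ (by dsimp only; omega) rfl
      simp only [Prod.mk.injEq, reduceCtorEq, and_false, false_or, SlotLT] at hlt₁
      have hlt₀ := hfirst _ hy₀ (by dsimp only; omega) rfl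
      simp only [Prod.mk.injEq, reduceCtorEq, and_false, false_or, SlotLT] at hlt₀
      omega

/-- Two consecutive directly committed highest-ranked slots decide all slots of earlier rounds. -/
theorem decided_of_directlyCommits (hL : 1 ≤ L) (hD : BddAbove (Block.round '' D)) {j : ℕ}
    {b₀ b₁ : Block n Tx} (hb₀ : DirectlyCommits f D j 0 b₀)
    (hb₁ : DirectlyCommits f D (j + 1) 0 b₁) {lo r l : ℕ} (hr : r < j) (hl : l < L)
    (hlo : lo ≤ r) : Decided f L D lo r l := by
  -- The committed block of round `j + 1` lies in `D`, so the procedure's range of rounds contains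
  -- `j` and `j + 1`.
  have hmem : j + 1 ∈ Block.round '' D := by
    obtain ⟨⟨⟨h1, h2⟩, -⟩, -⟩ := (hb₁ (.commit b₁)).2 rfl
    exact ⟨b₁, h1, h2⟩
  have hj : j + 1 ≤ sSup (Block.round '' D) := le_csSup hD hmem
  refine ⟨sSup (Block.round '' D), ⟨Nat.sSup_mem ⟨_, hmem⟩ hD, fun x hx => le_csSup hD hx⟩,
    exists_tryDecide f D _, fun S hS => ?_⟩
  have hrl : (r, l) ∈ S.map Prod.fst := by
    rw [hS.map_fst]
    exact mem_slots hlo (by omega) hl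
  obtain ⟨⟨_, s⟩, hs, rfl⟩ := List.mem_map.1 hrl
  refine ⟨s, hs, hS.ne_undecided hb₀ hb₁ (pairwise_slots _ _ _) (fun x _ _ => ?_) _ hs hr⟩
  exact ⟨mem_slots (by omega) (by omega) hL, mem_slots (by omega) hj hL⟩

end Decider

/-! ### Local DAGs -/

namespace Trace

variable {n : ℕ} {Tx : Type*} (E : Trace n Tx)

theorem received_mono (v : Fin n) {t t' : ℕ} (h : t ≤ t') : E.received v t ⊆ E.received v t' :=
  fun _ ⟨s, hs, hb⟩ => ⟨s, hs.trans h, hb⟩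

theorem dag_mono (f : ℕ) (v : Fin n) {t t' : ℕ} (h : t ≤ t') : E.dag f v t ⊆ E.dag f v t' :=
  fun _ ⟨hv, hh⟩ => ⟨hv, hh.trans (E.received_mono v h)⟩

theorem mem_dag_of_mem_history {f : ℕ} {v : Fin n} {t : ℕ} {b c : Block n Tx}
    (hb : b ∈ E.dag f v t) (hc : c ∈ b.history) : c ∈ E.dag f v t :=
  ⟨hb.1.of_mem_history hc, (Block.history_subset_of_mem hc).trans hb.2⟩

theorem entered_of_dag_subset {f : ℕ} {v w : Fin n} {r t t' : ℕ}
    (h : E.dag f v t ⊆ E.dag f w t') (he : E.Entered f v r t) : E.Entered f w r t' := by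
  cases r with
  | zero => trivial
  | succ r => exact le_trans he (authorCount_mono fun b hb => ⟨h hb.1, hb.2⟩)

theorem entered_mono {f : ℕ} {v : Fin n} {r t t' : ℕ} (h : t ≤ t')
    (he : E.Entered f v r t) : E.Entered f v r t' :=
  E.entered_of_dag_subset (E.dag_mono f v h) he

theorem proposed_mono {v : Fin n} {r t t' : ℕ} (h : t ≤ t') (hp : E.Proposed v r t) :
    E.Proposed v r t' := by
  obtain ⟨s, hs, hb⟩ := hp
  exact ⟨s, hs.trans h, hb⟩

end Trace

/-! ### Consequences of the network and broadcast assumptions -/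

namespace Execution

variable {n : ℕ} [NeZero n] {Tx : Type*} {f L Δ GST : ℕ} (E : Execution n Tx f L Δ GST)

/-- A foreign block comes in a message, which is unforgeable and takes a tick. The resulting strict
inequality is what later bounds rounds by time. -/
theorem propose_of_mem_received {v : Fin n} {t : ℕ} {b : Block n Tx} (hv : E.Honest v)
    (hb : b ∈ E.received v t) (ha : E.Honest b.author) :
    ∃ t' ≤ t, E.propose b.author t' b ∧ (b.author ≠ v → t' < t) := by
  obtain ⟨s, hs, hp | ⟨w, hr⟩⟩ := hb
  · have hav := E.propose_author v s b hv hp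
    exact ⟨s, hs, hav.symm ▸ hp, fun h => absurd hav h⟩
  · obtain ⟨s', hs', hsent⟩ := E.recv_sent w v s b hr
    obtain ⟨s'', hs'', hp⟩ := E.unforgeable w v s' b hsent b b.self_mem_history ha
    exact ⟨s'', by omega, hp, fun _ => by omega⟩

theorem propose_of_mem_dag {v : Fin n} {t : ℕ} {b : Block n Tx} (hv : E.Honest v)
    (hb : b ∈ E.dag f v t) (ha : E.Honest b.author) :
    ∃ t' ≤ t, E.propose b.author t' b ∧ (b.author ≠ v → t' < t) :=
  E.propose_of_mem_received hv (hb.2 b.self_mem_history) ha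

theorem eq_of_mem_dag {v : Fin n} {t s : ℕ} {b c : Block n Tx} (hv : E.Honest v)
    (hb : b ∈ E.dag f v t) (hc : E.Honest c.author) (hpc : E.propose c.author s c)
    (ha : b.author = c.author) (hr : b.round = c.round) : b = c := by
  obtain ⟨s', -, hp, -⟩ := E.propose_of_mem_dag hv hb (ha ▸ hc)
  rw [ha] at hp
  exact (E.propose_unique _ _ _ _ _ hc hp hpc hr).2

/-- An honest validator's own blocks are in its local DAG at once. -/
theorem mem_dag_of_propose {v : Fin n} {t : ℕ} {b : Block n Tx} (hv : E.Honest v)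
    (hp : E.propose v t b) : b ∈ E.dag f v t := by
  have hpar := E.parents_dag v t b hv hp
  refine ⟨.intro b (fun p hp => (hpar p hp).1.1) (fun p hp => (hpar p hp).2) fun hr => ?_, ?_⟩
  · obtain ⟨r, hr⟩ := Nat.exists_eq_add_one.2 hr
    have hent := (E.propose_ready v t b hv hp).1
    rw [hr] at hent
    -- The references cover all authors of the previous round in the DAG, so the quorum for entering
    -- is inherited by the block.
    refine le_trans hent (Set.ncard_le_ncard ?_ (Set.toFinite _))
    rintro _ ⟨c, ⟨hc, hcr⟩, rfl⟩
    obtain ⟨p, hpm, hpa, hpr⟩ := E.parents_all v t b hv hp c hc (by omega)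
    exact ⟨p, hpm, by omega, hpa⟩
  · intro c hc
    rcases Block.eq_or_mem_history_parent hc with rfl | ⟨p, hpm, hcp⟩
    · exact ⟨t, le_rfl, Or.inl hp⟩
    · exact (hpar p hpm).1.2 hcp

/-- Each block of the history of `b` is itself in the DAG of `v`, hence was sent to `w` by time `t`;
so the whole history arrives by the same deadline. -/
theorem dag_subset {v w : Fin n} (hv : E.Honest v) (hw : E.Honest w) (t : ℕ) :
    E.dag f v t ⊆ E.dag f w (max t GST + Δ) := by
  refine fun b hb => ⟨hb.1, fun c hc => ?_⟩
  obtain ⟨s, hs, hsent⟩ := E.broadcast v t c hv (E.mem_dag_of_mem_history hb hc) w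
  obtain ⟨s', hs', hrecv⟩ := E.delivery v w s c hv hw hsent
  exact ⟨s', by omega, Or.inr ⟨v, hrecv⟩⟩

theorem entered_within {v w : Fin n} (hv : E.Honest v) (hw : E.Honest w) {r t : ℕ}
    (h : E.Entered f v r t) : E.Entered f w r (max t GST + Δ) :=
  E.entered_of_dag_subset (E.dag_subset hv hw t) h

/-- Among `4 f + 1` authors at most `f` are Byzantine. -/
theorem exists_propose_of_entered {v : Fin n} (hv : E.Honest v) {r t : ℕ}
    (h : E.Entered f v (r + 1) t) : ∃ u, E.Honest u ∧ E.Proposed u r t := by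
  obtain ⟨b, ⟨hb, hbr⟩, hbX⟩ := exists_author_notMem E.byz
    (lt_of_lt_of_le (by have := E.byz_card; omega) h)
  obtain ⟨t', ht', hp, -⟩ := E.propose_of_mem_dag hv hb hbX
  exact ⟨b.author, hbX, t', ht', b, hp, hbr⟩

theorem proposed_pred {v : Fin n} (hv : E.Honest v) {r t : ℕ} {b : Block n Tx}
    (hp : E.propose v t b) (hr : b.round = r + 1) : E.Proposed v r t :=
  (E.propose_ready v t b hv hp).2.2 r hr.symm

/-! ### Every round is reached -/

theorem proposed_after_entered {v : Fin n} (hv : E.Honest v) {r t : ℕ}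
    (he : E.Entered f v r t) (hp : ∀ r', r' + 1 = r → E.Proposed v r' t) :
    E.Proposed v r (t + 2 * Δ) := by
  refine E.prompt v _ r hv ⟨E.entered_mono (by omega) he, ?_,
    fun r' hr' => E.proposed_mono (by omega) (hp r' hr')⟩
  cases r with
  | zero => trivial
  | succ r => exact Or.inr ⟨t, le_rfl, he⟩

theorem exists_dag_of_proposed (v : Fin n) (hv : E.Honest v) (r : ℕ)
    (h : ∀ u, E.Honest u → ∃ t, E.Proposed u r t) :
    ∃ T, ∀ u, E.Honest u → ∃ b ∈ roundBlocks (E.dag f v T) r, b.author = u := by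
  choose! s hs using h
  -- The arbitrary values of `s` at Byzantine validators can only enlarge the supremum, which does
  -- no harm.
  refine ⟨max (Finset.univ.sup s) GST + Δ, fun u hu => ?_⟩
  obtain ⟨t, ht, b, hp, hr⟩ := hs u hu
  have hle : s u ≤ Finset.univ.sup s := Finset.le_sup (Finset.mem_univ u)
  refine ⟨b, ⟨E.dag_mono f v ?_ (E.dag_subset hu hv t (E.mem_dag_of_propose hu hp)), hr⟩,
    E.propose_author u t b hu hp⟩
  omega

theorem exists_entered_and_proposed (hn : 5 * f + 1 ≤ n) (r : ℕ) (v : Fin n) (hv : E.Honest v) :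
    ∃ t, E.Entered f v r t ∧ E.Proposed v r t := by
  induction r generalizing v with
  | zero => exact ⟨0 + 2 * Δ, trivial, E.proposed_after_entered hv trivial (by omega)⟩
  | succ r ih =>
    obtain ⟨T, hT⟩ := E.exists_dag_of_proposed v hv r
      fun u hu => (ih u hu).imp fun _ h => h.2
    have hent : E.Entered f v (r + 1) T := le_authorCount_of_honest hn E.byz E.byz_card hT
    obtain ⟨t, -, hp⟩ := ih v hv
    refine ⟨max T t + 2 * Δ, E.entered_mono (by omega) hent,
      E.proposed_after_entered hv (E.entered_mono (le_max_left _ _) hent) fun r' hr' => ?_⟩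
    obtain rfl : r' = r := by omega
    exact E.proposed_mono (le_max_right _ _) hp

/-! ### Rounds take time -/

/-- If `f > 0`, the quorum of round `r + 1` has an honest author other than `v`, whose block was
created strictly earlier. If `f = 0`, that quorum may be the block of `v` alone, so the wait must
account for the delay: a timer takes `2 Δ > 0` ticks, and a leader other than `v` costs a message.
-/
theorem exists_earlier_propose (hn2 : 2 ≤ n) (hL : 1 ≤ L) (hΔ : 0 < Δ) {v : Fin n}
    (hv : E.Honest v) {r t : ℕ} {b : Block n Tx} (hp : E.propose v t b) (hr : b.round = r + 2) :
    ∃ u, E.Honest u ∧ ∃ t' < t, E.Proposed u r t' := by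
  have hready := E.propose_ready v t b hv hp
  rw [hr] at hready
  obtain ⟨hent, hwait, hprev⟩ := hready
  have key : ∀ c ∈ E.dag f v t, E.Honest c.author → c.author ≠ v → c.round = r + 1 →
      ∃ u, E.Honest u ∧ ∃ t' < t, E.Proposed u r t' := fun c hc hca hcv hcr => by
    obtain ⟨t', -, hpc, hlt⟩ := E.propose_of_mem_dag hv hc hca
    exact ⟨c.author, hca, t', hlt hcv, E.proposed_pred hca hpc hcr⟩
  rcases Nat.eq_zero_or_pos f with hf | hf
  · have hhonest : ∀ u, E.Honest u := fun u hu => by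
      have := Finset.card_pos.2 ⟨u, hu⟩
      have := E.byz_card
      omega
    rcases hwait with hlead | ⟨t₀, ht₀, hent₀⟩
    · obtain ⟨c, ⟨hc, hcr⟩, hca⟩ := hlead 0 hL
      by_cases hcv : c.author = v
      · obtain ⟨t₁, ht₁, b₁, hp₁, hr₁⟩ := hprev (r + 1) rfl
        have hwait₁ := (E.propose_ready v t₁ b₁ hv hp₁).2.1
        rw [hr₁] at hwait₁
        rcases hwait₁ with hlead₁ | ⟨t₀, ht₀, hent₀⟩
        · obtain ⟨d, ⟨hd, hdr⟩, hda⟩ := hlead₁ 0 hL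
          have hdv : d.author ≠ v := by
            rw [hda, ← hcv, hca]
            exact leader_ne (by omega) (by omega)
          obtain ⟨t', -, hpd, hlt⟩ := E.propose_of_mem_dag hv hd (hhonest _)
          exact ⟨d.author, hhonest _, t', (hlt hdv).trans_le ht₁, t', le_rfl, d, hpd, hdr⟩
        · obtain ⟨u, hu, hup⟩ := E.exists_propose_of_entered hv hent₀
          exact ⟨u, hu, t₀, by omega, hup⟩
      · exact key c hc (hhonest _) hcv hcr
    · obtain ⟨u, hu, t', ht', c, hpc, hcr⟩ := E.exists_propose_of_entered hv hent₀
      exact ⟨u, hu, t', by omega, E.proposed_pred hu hpc hcr⟩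
  · obtain ⟨c, ⟨hc, hcr⟩, hcX⟩ := exists_author_notMem (insert v E.byz)
      (lt_of_lt_of_le (by
        have := E.byz_card
        have := Finset.card_insert_le v E.byz
        omega) hent)
    rw [Finset.mem_insert, not_or] at hcX
    exact key c hc hcX.2 hcX.1 hcr

/-- Two rounds cost at least one tick; the `+ 1` allows for round `1` at time `0`. -/
theorem round_le_of_proposed (hn2 : 2 ≤ n) (hL : 1 ≤ L) (hΔ : 0 < Δ) {v : Fin n}
    (hv : E.Honest v) {r t : ℕ} (hp : E.Proposed v r t) : r ≤ 2 * t + 1 := by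
  induction r using Nat.twoStepInduction generalizing v t with
  | zero => omega
  | one => omega
  | more r ih _ =>
    obtain ⟨s, hs, b, hb, hr⟩ := hp
    obtain ⟨u, hu, t', ht', hup⟩ := E.exists_earlier_propose hn2 hL hΔ hv hb hr
    have := ih hu hup
    omega

/-- Byzantine blocks obey no timing, but validity gives them an honest parent in the round just
below. -/
theorem bddAbove_round_dag (hn2 : 2 ≤ n) (hL : 1 ≤ L) (hΔ : 0 < Δ) {v : Fin n}
    (hv : E.Honest v) (t : ℕ) : BddAbove (Block.round '' E.dag f v t) := by
  refine ⟨2 * t + 2, ?_⟩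
  rintro _ ⟨b, hb, rfl⟩
  rcases Nat.eq_zero_or_pos b.round with h0 | hpos
  · omega
  obtain ⟨p, hpm, hpr, hpX⟩ := hb.1.exists_parent_author_notMem hpos E.byz
    (by have := E.byz_card; omega)
  obtain ⟨t', ht', hpp, -⟩ := E.propose_of_mem_dag hv
    (E.mem_dag_of_mem_history hb (Block.mem_history_of_mem_parents hpm)) hpX
  have := E.round_le_of_proposed hn2 hL hΔ hpX ⟨t', ht', p, hpp, rfl⟩
  omega

theorem exists_forall_afterGST (hn2 : 2 ≤ n) (hL : 1 ≤ L) (hΔ : 0 < Δ) :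
    ∃ R, ∀ r ≥ R, E.AfterGST r := by
  refine ⟨2 * (GST + 2 * Δ) + 2, fun r hr v t hv he => ?_⟩
  obtain ⟨r, rfl⟩ : ∃ r', r = r' + 1 := ⟨r - 1, by omega⟩
  obtain ⟨u, hu, hup⟩ := E.exists_propose_of_entered hv he
  have := E.round_le_of_proposed hn2 hL hΔ hu hup
  omega

/-! ### Honest leaders are committed after GST -/

/-- Whatever allowed `u` to create its block allows `v` to do so `Δ` later; the induction supplies
the earlier blocks of `v`. -/
theorem proposed_within {u v : Fin n} (hu : E.Honest u) (hv : E.Honest v) {r t : ℕ}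
    (ht : GST + 2 * Δ ≤ t) (hp : E.Proposed u r t) : E.Proposed v r (t + Δ) := by
  induction r with
  | zero => exact E.prompt v _ 0 hv ⟨trivial, trivial, by omega⟩
  | succ r ih =>
    obtain ⟨s, hs, b, hb, hr⟩ := hp
    have hready := E.propose_ready u s b hu hb
    rw [hr] at hready
    obtain ⟨hent, hwait, -⟩ := hready
    refine E.prompt v _ (r + 1) hv
      ⟨E.entered_mono (by omega) (E.entered_within hu hv hent), ?_, fun r' hr' => ?_⟩
    · rcases hwait with hlead | ⟨t₀, ht₀, hent₀⟩
      · refine Or.inl fun l hl => (hlead l hl).mono fun c hc => ⟨⟨?_, hc.1.2⟩, hc.2⟩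
        exact E.dag_mono f v (by omega) (E.dag_subset hu hv s hc.1.1)
      -- The timer of `v` has run out by `max t₀ GST + 3 Δ`, which is at most `t + Δ` because both
      -- `t₀ + 2 Δ` and `GST + 2 Δ` are at most `t`. This is why rounds after GST start at `GST + 2
      -- Δ`.
      · exact Or.inr ⟨max t₀ GST + Δ, by omega, E.entered_within hu hv hent₀⟩
    · obtain rfl : r' = r := by omega
      exact ih (E.proposed_mono hs (E.proposed_pred hu hb hr))

/-- After GST, every honest validator has the block of an honest leader when it creates its block
of the next round. -/
theorem leader_mem_dag {r l : ℕ} (hr : E.AfterGST r) (hl : l < L) {b : Block n Tx} {s : ℕ}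
    (hbr : b.round = r) (hv : E.Honest (leader n r l)) (hb : E.propose (leader n r l) s b)
    {w : Fin n} (hw : E.Honest w) {t : ℕ} {c : Block n Tx} (hc : E.propose w t c)
    (hcr : c.round = r + 1) : b ∈ E.dag f w t := by
  have hba := E.propose_author _ _ _ hv hb
  have hwait := (E.propose_ready w t c hw hc).2.1
  rw [hcr] at hwait
  rcases hwait with hlead | ⟨t₀, ht₀, hent₀⟩
  · obtain ⟨d, ⟨hd, hdr⟩, hda⟩ := hlead l hl
    rw [← E.eq_of_mem_dag hw hd (hba.symm ▸ hv) (hba.symm ▸ hb) (hda.trans hba.symm)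
      (hdr.trans hbr.symm)]
    exact hd
  -- Some honest `u` created a block of round `r` at `t' ≤ t₀`. The leader follows by `t' + Δ`, and
  -- its block reaches `w` by `t' + 2 Δ ≤ t₀ + 2 Δ ≤ t`: the timeout is exactly long enough.
  · obtain ⟨u, hu, t', ht', d, hd, hdr⟩ := E.exists_propose_of_entered hw hent₀
    have hentu := (E.propose_ready u t' d hu hd).1
    rw [hdr] at hentu
    have hgst := hr u t' hu hentu
    obtain ⟨s', hs', b', hb', hbr'⟩ := E.proposed_within hu hv hgst ⟨t', le_rfl, d, hd, hdr⟩
    obtain ⟨rfl, rfl⟩ := E.propose_unique _ _ _ _ _ hv hb hb' (hbr.trans hbr'.symm)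
    exact E.dag_mono f w (by omega) (E.dag_subset hv hw s (E.mem_dag_of_propose hv hb))

/-- Having `b` in its DAG, `w` must reference a block of that author and round. The leader does not
equivocate, so this is `b`, and the search can meet no other block of the slot. -/
theorem isVote_leader {r l : ℕ} (hr : E.AfterGST r) (hl : l < L) {b : Block n Tx} {s : ℕ}
    (hbr : b.round = r) (hv : E.Honest (leader n r l)) (hb : E.propose (leader n r l) s b)
    {w : Fin n} (hw : E.Honest w) {t : ℕ} {c : Block n Tx} (hc : E.propose w t c)
    (hcr : c.round = r + 1) : c.IsVote b := by
  have hba := E.propose_author _ _ _ hv hb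
  have huniq : ∀ d ∈ E.dag f w t, d.author = b.author → d.round = b.round → d = b :=
    fun d hd => E.eq_of_mem_dag hw hd (hba.symm ▸ hv) (hba.symm ▸ hb)
  obtain ⟨p, hpm, hpa, hpr⟩ := E.parents_all w t c hw hc b
    (E.leader_mem_dag hr hl hbr hv hb hw hc hcr) (by omega)
  obtain rfl := huniq p (E.parents_dag w t c hw hc p hpm).1 hpa hpr
  exact Block.isVote_of_mem_parents hpm (by omega) fun d hd =>
    huniq d (E.mem_dag_of_mem_history (E.mem_dag_of_propose hw hc) hd)

theorem eventuallyDirectlyCommitted (hn : 5 * f + 1 ≤ n) {r l : ℕ} (hr : E.AfterGST r)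
    (hl : l < L) (hv : E.Honest (leader n r l)) : E.EventuallyDirectlyCommitted r l := by
  obtain ⟨_, -, s, -, b, hb, hbr⟩ := E.exists_entered_and_proposed hn r _ hv
  have hba := E.propose_author _ _ _ hv hb
  refine ⟨b, hbr, ⟨s, hb⟩, fun w hw => ?_⟩
  obtain ⟨T, hT⟩ := E.exists_dag_of_proposed w hw (r + 1) fun u hu =>
    (E.exists_entered_and_proposed hn (r + 1) u hu).imp fun _ h => h.2
  refine ⟨max T (max s GST + Δ), fun t ht => ?_⟩
  have hbD : b ∈ leaderBlocks (E.dag f w t) r l :=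
    ⟨⟨E.dag_mono f w (by omega) (E.dag_subset hv hw s (E.mem_dag_of_propose hv hb)), hbr⟩, hba⟩
  have huniq : ∀ d ∈ leaderBlocks (E.dag f w t) r l, d = b := fun d hd =>
    E.eq_of_mem_dag hw hd.1.1 (hba.symm ▸ hv) (hba.symm ▸ hb) (hd.2.trans hba.symm)
      (hd.1.2.trans hbr.symm)
  have hvote : ∀ c ∈ roundBlocks (E.dag f w t) (r + 1), E.Honest c.author → c.IsVote b :=
    fun c hc hca => by
      obtain ⟨t', -, hpc, -⟩ := E.propose_of_mem_dag hw hc.1 hca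
      exact E.isVote_leader hr hl hbr hv hb hca hpc hc.2
  have hcert : StronglyCertified f (E.dag f w t) b := by
    refine le_authorCount_of_honest hn E.byz E.byz_card fun u hu => ?_
    obtain ⟨c, ⟨hc, hcr⟩, rfl⟩ := hT u hu
    have hc' : c ∈ roundBlocks (E.dag f w t) (r + 1) := ⟨E.dag_mono f w (by omega) hc, hcr⟩
    exact ⟨c, ⟨hbr.symm ▸ hc', hvote c hc' hu⟩, rfl⟩
  have hskip : ¬ Skipped f (E.dag f w t) b := fun h => by
    obtain ⟨c, ⟨hc, hcv⟩, hcX⟩ := exists_author_notMem E.byz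
      (lt_of_lt_of_le (by have := E.byz_card; omega) h)
    rw [hbr] at hc
    exact hcv (hvote c hc hcX)
  intro st
  refine ⟨fun h => ?_, fun h => h ▸ ⟨hbD, hskip, hcert⟩⟩
  cases st with
  | commit d => rw [huniq d h.1]
  | skip =>
    obtain ⟨d, hd, hds⟩ := h
    exact absurd (huniq d hd ▸ hds) hskip
  | undecided => exact absurd hcert (h b hbD).2

/-! ### All slots are decided -/

theorem eventually_decided (hn2 : 2 ≤ n) (hL : 1 ≤ L) (hΔ : 0 < Δ) {j : ℕ}
    (h₀ : E.EventuallyDirectlyCommitted j 0) (h₁ : E.EventuallyDirectlyCommitted (j + 1) 0)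
    {v : Fin n} (hv : E.Honest v) :
    ∃ T, ∀ t ≥ T, ∀ r < j, ∀ l < L, ∀ lo ≤ r, Decided f L (E.dag f v t) lo r l := by
  obtain ⟨b₀, -, -, hb₀⟩ := h₀
  obtain ⟨b₁, -, -, hb₁⟩ := h₁
  obtain ⟨T₀, hT₀⟩ := hb₀ v hv
  obtain ⟨T₁, hT₁⟩ := hb₁ v hv
  exact ⟨max T₀ T₁, fun t ht r hr l hl lo hlo =>
    decided_of_directlyCommits hL (E.bddAbove_round_dag hn2 hL hΔ hv t)
      (hT₀ t (by omega)) (hT₁ t (by omega)) hr hl hlo⟩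

/-- Entering round `k + 1` needs an honest block of round `k`, whose author had entered round `k` no
later. -/
theorem AfterGST.mono {r r' : ℕ} (h : E.AfterGST r) (hrr' : r ≤ r') : E.AfterGST r' := by
  induction r', hrr' using Nat.le_induction with
  | base => exact h
  | succ k _ ih =>
    intro v t hv he
    obtain ⟨u, hu, t', ht', b, hb, hbr⟩ := E.exists_propose_of_entered hv he
    have hent := (E.propose_ready u t' b hu hb).1
    rw [hbr] at hent
    exact (ih u t' hu hent).trans ht'

theorem exists_decided_before (hn2 : 2 ≤ n) (hn : 5 * f + 1 ≤ n) (hL : 1 ≤ L) (hΔ : 0 < Δ)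
    {r₀ : ℕ} (hr₀ : E.AfterGST r₀) :
    ∃ j, r₀ ≤ j ∧ j + 1 ≤ r₀ + (2 * f + 1) ∧
      E.Honest (leader n j 0) ∧ E.Honest (leader n (j + 1) 0) ∧
      E.EventuallyDirectlyCommitted j 0 ∧ E.EventuallyDirectlyCommitted (j + 1) 0 ∧
      ∀ v, E.Honest v → ∃ T, ∀ t ≥ T, ∀ r < j, ∀ l < L, ∀ lo ≤ r,
        Decided f L (E.dag f v t) lo r l := by
  obtain ⟨j, hj, hj', h₀, h₁⟩ :=
    exists_consecutive_leaders_notMem hn2 hn E.byz E.byz_card r₀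
  have hc₀ := E.eventuallyDirectlyCommitted hn (hr₀.mono E hj) hL h₀
  have hc₁ := E.eventuallyDirectlyCommitted hn (hr₀.mono E (by omega)) hL h₁
  exact ⟨j, hj, hj', h₀, h₁, hc₀, hc₁, fun v hv => E.eventually_decided hn2 hL hΔ hc₀ hc₁ hv⟩

end Execution

end BBCore

theorem mainTheorem3 {n : ℕ} [NeZero n] {Tx : Type*} {f L Δ GST : ℕ}
    (hn2 : 2 ≤ n) (hn : 5 * f + 1 ≤ n) (hL : 1 ≤ L) (hL' : L ≤ 4 * f + 1) (hΔ : 0 < Δ)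
    (E : BBCore.Execution n Tx f L Δ GST) :
    -- every honest validator enters every round and creates a block in it
    (∀ r v, E.Honest v → ∃ t, E.Entered f v r t ∧ E.Proposed v r t) ∧
    -- once an honest validator has entered a round, all do so within `Δ` (after GST)
    (∀ r v w t, E.Honest v → E.Honest w → E.Entered f v r t →
      E.Entered f w r (max t GST + Δ)) ∧
    -- all rounds but finitely many lie after GST
    (∃ R, ∀ r ≥ R, E.AfterGST r) ∧
    -- after GST, the blocks of honest leaders are directly committed
    (∀ r l, E.AfterGST r → l < L → E.Honest (BBCore.leader n r l) →
      E.EventuallyDirectlyCommitted r l) ∧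
    -- any `2 f + 2` rounds contain two consecutive ones with honest highest-ranked leaders
    (∀ r₀, ∃ j, r₀ ≤ j ∧ j + 1 ≤ r₀ + (2 * f + 1) ∧
      E.Honest (BBCore.leader n j 0) ∧ E.Honest (BBCore.leader n (j + 1) 0)) ∧
    -- after GST, both are directly committed, and then all earlier slots are decided
    (∀ r₀, E.AfterGST r₀ → ∃ j, r₀ ≤ j ∧ j + 1 ≤ r₀ + (2 * f + 1) ∧
      E.Honest (BBCore.leader n j 0) ∧ E.Honest (BBCore.leader n (j + 1) 0) ∧
      E.EventuallyDirectlyCommitted j 0 ∧ E.EventuallyDirectlyCommitted (j + 1) 0 ∧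
      ∀ v, E.Honest v → ∃ T, ∀ t ≥ T, ∀ r < j, ∀ l < L, ∀ lo ≤ r,
        BBCore.Decided f L (E.dag f v t) lo r l) ∧
    -- every leader slot is eventually decided by every honest validator
    (∀ r l v, l < L → E.Honest v → ∃ T, ∀ t ≥ T, ∀ lo ≤ r,
      BBCore.Decided f L (E.dag f v t) lo r l) := by
  refine ⟨fun r v hv => E.exists_entered_and_proposed hn r v hv,
    fun r v w t hv hw h => E.entered_within hv hw h,
    E.exists_forall_afterGST hn2 hL hΔ,
    fun r l hr hl hv => E.eventuallyDirectlyCommitted hn hr hl hv,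
    fun r₀ => BBCore.exists_consecutive_leaders_notMem hn2 hn E.byz E.byz_card r₀,
    fun r₀ hr₀ => E.exists_decided_before hn2 hn hL hΔ hr₀, fun r l v hl hv => ?_⟩
  obtain ⟨R, hR⟩ := E.exists_forall_afterGST hn2 hL hΔ
  -- The window starts after GST and beyond round `r`, so that `r < j`.
  obtain ⟨j, hj, -, -, -, -, -, hdec⟩ :=
    E.exists_decided_before hn2 hn hL hΔ (hR (max R (r + 1)) (le_max_left _ _))
  obtain ⟨T, hT⟩ := hdec v hv
  exact ⟨T, fun t ht lo hlo => hT t ht r (by omega) l hl lo hlo⟩
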